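/- Let $G$ be a finite group and let $[G/G]$ be the (zero-dimensional, compact) orbifold presented by the action groupoid $\mathcal G$ of $G$ acting on itself by conjugation. Let $\tilde{\mathcal G}$ be its inertia groupoid (pairs $(x,g)$ of an object $x$ of $\mathcal G$ and a loop $g$ at $x$), let $\tilde{\mathcal G}^{[2]}$ be the groupoid of $2$-sectors $(x,g_1,g_2)$, and let $e_1,e_2,e_{12}:\tilde{\mathcal G}^{[2]}\to\tilde{\mathcal G}$ be the evaluation maps sending $(x,g_1,g_2)$ to $(x,g_1)$, $(x,g_2)$ and $(x,g_1g_2)$. The Chen–Ruan cohomology $H_{CR}([G/G],\mathbb C)$ is the de Rham cohomology $H^*(\tilde{\mathcal G},\mathbb C)$ with the product $$\omega_1 *_{CR}\omega_2=(e_{12})_*\bigl(e_1^*\omega_1\cup e_2^*\omega_2\cup e(E^{[2]})\bigr),$$ where $(e_{12})_*$ is the push-forward given by orbifold integration over the fibres and $e(E^{[2]})$ is the Euler class of the Chen–Ruan obstruction bundle $E^{[2]}$ over $\tilde{\mathcal G}^{[2]}$. Let $\tilde G=\{(g,h)\in G\times G : gh=hg\}$, with $G$ acting by simultaneous conjugation,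 and let $\mathcal C_G(\tilde G)$ be the complex vector space of $G$-invariant functions $\tilde G\to\mathbb C$. With the product $$(f_1 *_2 f_2)(g,h)=\sum_{\substack{h_1,h_2\in Z_G(g)\\ h_1h_2=h}} f_1(g,h_1)\,f_2(g,h_2),$$ where $Z_G(g)$ is the centralizer of $g$ in $G$, it is a ring. Then there is a ($\mathbb C$-linear) ring isomorphism $$\bigl(H_{CR}([G/G],\mathbb C),\,*_{CR}\bigr)\;\cong\;\bigl(\mathcal C_G(\tilde G),\,*_2\bigr).$$ -/

import Mathlib

open CategoryTheory DirectSum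

noncomputable section

namespace ChenRuan

universe u v w

/-!
## Compact orbifolds of dimension zero

A compact zero-dimensional orbifold is presented by a groupoid `𝒢` with finitely many objects and
finitely many arrows between any two objects: the discrete manifolds `𝒢₀`, `𝒢₁` then form a
proper étale Lie groupoid with compact orbit space.  Composition of arrows is written in
diagrammatic order `f ≫ g`, that is, `g₁ · g₂` with `t g₁ = s g₂`.
-/

/-! ### Multi-sectors -/

/-- Objects of the groupoid of `k`-sectors: a point with a `k`-tuple of loops at it.
For `k = 1` this is the inertia groupoid. -/
structure Sector (𝒢 : Type u) [Groupoid.{v} 𝒢] (k : ℕ) where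
  pt : 𝒢
  loop : Fin k → (pt ⟶ pt)

/-- Arrows of the groupoid of `k`-sectors: an arrow `h` of `𝒢` leads from `(g₁, …, g_k)` to
`(h⁻¹ g₁ h, …, h⁻¹ g_k h)`. -/
instance (𝒢 : Type u) [Groupoid.{v} 𝒢] (k : ℕ) : Groupoid.{v} (Sector 𝒢 k) where
  Hom a b := {h : a.pt ⟶ b.pt // ∀ i, b.loop i = Groupoid.inv h ≫ a.loop i ≫ h}
  id a := ⟨𝟙 a.pt, fun i => by simp⟩
  comp f g := ⟨f.1 ≫ g.1, fun i => by rw [g.2 i, f.2 i]; simp⟩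
  inv f := ⟨Groupoid.inv f.1, fun i => by rw [f.2 i]; simp⟩
  id_comp f := Subtype.ext (Category.id_comp f.1)
  comp_id f := Subtype.ext (Category.comp_id f.1)
  assoc f g h := Subtype.ext (Category.assoc f.1 g.1 h.1)
  inv_comp f := Subtype.ext (Groupoid.inv_comp f.1)
  comp_inv f := Subtype.ext (Groupoid.comp_inv f.1)

section Sectors

variable (𝒢 : Type u) [Groupoid.{v} 𝒢]

/-- The inertia groupoid. -/
abbrev Inertia := Sector 𝒢 1

/-- The evaluation `e₁ : (x, g₁, g₂) ↦ (x, g₁)`. -/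
def e₁ : Sector 𝒢 2 ⥤ Inertia 𝒢 where
  obj a := ⟨a.pt, fun _ => a.loop 0⟩
  map h := ⟨h.1, fun _ => h.2 0⟩

/-- The evaluation `e₂ : (x, g₁, g₂) ↦ (x, g₂)`. -/
def e₂ : Sector 𝒢 2 ⥤ Inertia 𝒢 where
  obj a := ⟨a.pt, fun _ => a.loop 1⟩
  map h := ⟨h.1, fun _ => h.2 1⟩

/-- The evaluation `e₁₂ : (x, g₁, g₂) ↦ (x, g₁ g₂)`. -/
def e₁₂ : Sector 𝒢 2 ⥤ Inertia 𝒢 where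
  obj a := ⟨a.pt, fun _ => a.loop 0 ≫ a.loop 1⟩
  map {a b} h := ⟨h.1, fun _ => by
    show b.loop 0 ≫ b.loop 1 = _
    rw [h.2 0, h.2 1]; simp⟩

/-- The involution `(x, g) ↦ (x, g⁻¹)` on objects of the inertia groupoid. -/
def invol {𝒢 : Type u} [Groupoid.{v} 𝒢] (a : Inertia 𝒢) : Inertia 𝒢 :=
  ⟨a.pt, fun i => Groupoid.inv (a.loop i)⟩

end Sectors

instance (𝒢 : Type u) [Groupoid.{v} 𝒢] (k : ℕ) [Finite 𝒢] [∀ x y : 𝒢, Finite (x ⟶ y)] :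
    Finite (Sector 𝒢 k) :=
  Finite.of_injective (β := Σ x : 𝒢, Fin k → (x ⟶ x)) (fun a => ⟨a.pt, a.loop⟩) (by
    rintro ⟨a, l⟩ ⟨b, m⟩ h
    cases h
    rfl)

instance (𝒢 : Type u) [Groupoid.{v} 𝒢] (k : ℕ) [∀ x y : 𝒢, Finite (x ⟶ y)]
    (a b : Sector 𝒢 k) : Finite (a ⟶ b) :=
  inferInstanceAs
    (Finite {h : a.pt ⟶ b.pt // ∀ i, b.loop i = Groupoid.inv h ≫ a.loop i ≫ h})

/-! ### Tangent spaces and differential forms -/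

/-- The (complex) tangent space at any point of a manifold of dimension zero. -/
abbrev Tan := EuclideanSpace ℂ (Fin 0)

/-- The action of an arrow `x ⟶ y` of an étale groupoid of dimension zero on tangent spaces,
i.e. the derivative of the germ of a diffeomorphism it defines.  There is only one linear map
between the zero spaces `T_x 𝒢₀` and `T_y 𝒢₀`. -/
def tangentMap {𝒢 : Type u} [Groupoid.{v} 𝒢] {x y : 𝒢} (_ : x ⟶ y) : Tan →L[ℂ] Tan :=
  ContinuousLinearMap.id ℂ Tan

/-- The `𝒢`-invariant complex-valued differential `p`-forms on `𝒢₀`, i.e. those with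
`s^* ω = t^* ω` on `𝒢₁`. -/
def formSubmodule (𝒢 : Type u) [Groupoid.{v} 𝒢] (p : ℕ) :
    Submodule ℂ (𝒢 → Tan [⋀^Fin p]→L[ℝ] ℂ) where
  carrier := {ω | ∀ (x y : 𝒢) (f : x ⟶ y),
    (ω y).compContinuousLinearMap ((tangentMap f).restrictScalars ℝ) = ω x}
  zero_mem' := fun _ _ _ => by ext; rfl
  add_mem' := fun ha hb x y f => by
    rw [Pi.add_apply, Pi.add_apply, ← ha x y f, ← hb x y f]; rfl
  smul_mem' := fun c a ha x y f => by
    rw [Pi.smul_apply, Pi.smul_apply, ← ha x y f]; rfl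

/-- The space of invariant `p`-forms. -/
def Form (𝒢 : Type u) [Groupoid.{v} 𝒢] (p : ℕ) : Type u := formSubmodule 𝒢 p

instance (𝒢 : Type u) [Groupoid.{v} 𝒢] (p : ℕ) : AddCommGroup (Form 𝒢 p) :=
  inferInstanceAs (AddCommGroup (formSubmodule 𝒢 p))

instance (𝒢 : Type u) [Groupoid.{v} 𝒢] (p : ℕ) : Module ℂ (Form 𝒢 p) :=
  inferInstanceAs (Module ℂ (formSubmodule 𝒢 p))

section Cohomology

variable (𝒢 : Type u) [Groupoid.{v} 𝒢]

theorem form_map {𝒢 : Type u} [Groupoid.{v} 𝒢] {p : ℕ} (ω : Form 𝒢 p) {x y : 𝒢} (f : x ⟶ y) :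
    ω.1 y = ω.1 x := by
  rw [← ω.2 x y f]; ext; rfl

theorem mem_form {𝒢 : Type u} [Groupoid.{v} 𝒢] {p : ℕ} (ω : 𝒢 → Tan [⋀^Fin p]→L[ℝ] ℂ)
    (h : ∀ (x y : 𝒢), (x ⟶ y) → ω y = ω x) : ω ∈ formSubmodule 𝒢 p := by
  intro x y f
  rw [← h x y f]; ext; rfl

instance subsingleton_alt (p : ℕ) : Subsingleton (Tan [⋀^Fin (p + 1)]→L[ℝ] ℂ) :=
  ⟨fun a b => by
    ext m
    rw [Subsingleton.elim m 0, a.map_zero, b.map_zero]⟩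

instance subsingleton_form (p : ℕ) : Subsingleton (Form 𝒢 (p + 1)) :=
  ⟨fun _ _ => Subtype.ext (funext fun _ => Subsingleton.elim _ _)⟩

/-- The exterior derivative.  In the chart `{x} ≅ ℝ⁰` at a point `x` the form `ω` is the form on
the zero vector space which takes the value `ω x`. -/
def dForm (p : ℕ) : Form 𝒢 p →ₗ[ℂ] Form 𝒢 (p + 1) where
  toFun ω := ⟨fun x => extDeriv (fun _ : Tan => ω.1 x) 0,
    mem_form _ fun x y f => by rw [form_map ω f]⟩
  map_add' _ _ := Subsingleton.elim _ _
  map_smul' _ _ := Subsingleton.elim _ _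

/-- Exact `p`-forms. -/
def exact : (p : ℕ) → Submodule ℂ (Form 𝒢 p)
  | 0 => ⊥
  | p + 1 => LinearMap.range (dForm 𝒢 p)

/-- The de Rham cohomology `H^p(𝒢, ℂ)`: closed invariant forms modulo exact ones. -/
abbrev deRham (p : ℕ) : Type u :=
  LinearMap.ker (dForm 𝒢 p) ⧸ (exact 𝒢 p).comap (LinearMap.ker (dForm 𝒢 p)).subtype

theorem exact_eq_bot (p : ℕ) : exact 𝒢 p = ⊥ := by
  cases p with
  | zero => rfl
  | succ p => exact Subsingleton.elim _ _

theorem mem_ker_dForm (p : ℕ) (ω : Form 𝒢 p) : ω ∈ LinearMap.ker (dForm 𝒢 p) :=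
  Subsingleton.elim _ _

variable {𝒢}

/-- The cohomology class of a form (each form is closed, see `mem_ker_dForm`). -/
def cls (p : ℕ) : Form 𝒢 p →ₗ[ℂ] deRham 𝒢 p :=
  (Submodule.mkQ _).comp (LinearMap.id.codRestrict (LinearMap.ker (dForm 𝒢 p))
    (mem_ker_dForm 𝒢 p))

theorem exact_le_ker {M : Type w} [AddCommGroup M] [Module ℂ M] {p : ℕ} (F : Form 𝒢 p →ₗ[ℂ] M) :
    (exact 𝒢 p).comap (LinearMap.ker (dForm 𝒢 p)).subtype ≤
      LinearMap.ker (F.comp (LinearMap.ker (dForm 𝒢 p)).subtype) := by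
  rintro ⟨ω, hω⟩ h
  have h' : ω ∈ exact 𝒢 p := h
  rw [exact_eq_bot, Submodule.mem_bot] at h'
  subst h'
  exact F.map_zero

/-- A linear map on forms descends to cohomology if it kills the exact forms; here there are
none but `0`. -/
def descend {M : Type w} [AddCommGroup M] [Module ℂ M] {p : ℕ} (F : Form 𝒢 p →ₗ[ℂ] M) :
    deRham 𝒢 p →ₗ[ℂ] M :=
  Submodule.liftQ _ (F.comp (LinearMap.ker (dForm 𝒢 p)).subtype) (exact_le_ker F)

/-! ### Cup product -/

/-- The wedge product of alternating forms on the tangent space. -/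
def wedge {p q : ℕ} (a : Tan [⋀^Fin p]→L[ℝ] ℂ) (b : Tan [⋀^Fin q]→L[ℝ] ℂ) :
    Tan [⋀^Fin (p + q)]→L[ℝ] ℂ :=
  let c : Tan [⋀^Fin (p + q)]→ₗ[ℝ] ℂ :=
    ((LinearMap.mul' ℝ ℂ).compAlternatingMap
      (a.toAlternatingMap.domCoprod b.toAlternatingMap)).domDomCongr finSumFinEquiv
  { c with cont := continuous_of_const fun v w => congrArg c (Subsingleton.elim v w) }

theorem wedge_apply {p q : ℕ} (a : Tan [⋀^Fin p]→L[ℝ] ℂ) (b : Tan [⋀^Fin q]→L[ℝ] ℂ)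
    (v : Fin (p + q) → Tan) :
    wedge a b v = LinearMap.mul' ℝ ℂ (AlternatingMap.domCoprod' 
      (a.toAlternatingMap ⊗ₜ[ℝ] b.toAlternatingMap) (v ∘ finSumFinEquiv)) := rfl

theorem wedge_add_left {p q : ℕ} (a a' : Tan [⋀^Fin p]→L[ℝ] ℂ) (b : Tan [⋀^Fin q]→L[ℝ] ℂ) :
    wedge (a + a') b = wedge a b + wedge a' b := by
  ext v
  rw [ContinuousAlternatingMap.add_apply]
  simp only [wedge_apply]
  rw [show (a + a').toAlternatingMap = a.toAlternatingMap + a'.toAlternatingMap from rfl,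
    TensorProduct.add_tmul, map_add, AlternatingMap.add_apply, map_add]

theorem wedge_add_right {p q : ℕ} (a : Tan [⋀^Fin p]→L[ℝ] ℂ) (b b' : Tan [⋀^Fin q]→L[ℝ] ℂ) :
    wedge a (b + b') = wedge a b + wedge a b' := by
  ext v
  rw [ContinuousAlternatingMap.add_apply]
  simp only [wedge_apply]
  rw [show (b + b').toAlternatingMap = b.toAlternatingMap + b'.toAlternatingMap from rfl,
    TensorProduct.tmul_add, map_add, AlternatingMap.add_apply, map_add]

/-- The wedge product of invariant forms. -/
def wedgeForm {p q : ℕ} (a : Form 𝒢 p) (b : Form 𝒢 q) : Form 𝒢 (p + q) :=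
  ⟨fun x => wedge (a.1 x) (b.1 x), mem_form _ fun x y f => by rw [form_map a f, form_map b f]⟩

theorem cls_surjective (p : ℕ) : Function.Surjective (cls (𝒢 := 𝒢) p) := by
  intro a
  obtain ⟨⟨ω, hω⟩, rfl⟩ := Submodule.mkQ_surjective _ a
  exact ⟨ω, rfl⟩

theorem cls_injective (p : ℕ) : Function.Injective (cls (𝒢 := 𝒢) p) := by
  intro a b h
  have h' := (Submodule.Quotient.eq _).1 h
  have h'' : a - b ∈ exact 𝒢 p := h'
  rw [exact_eq_bot, Submodule.mem_bot] at h''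
  exact sub_eq_zero.1 h''

/-- The cup product of de Rham classes: `[a] ∪ [b] = [a ∧ b]`. -/
def cup {p q : ℕ} (a : deRham 𝒢 p) (b : deRham 𝒢 q) : deRham 𝒢 (p + q) :=
  Quotient.liftOn₂' a b (fun a b => cls (p + q) (wedgeForm a.1 b.1)) (by
    intro a b a' b' ha hb
    have h1 : a.1 = a'.1 := cls_injective p (Quotient.sound' ha)
    have h2 : b.1 = b'.1 := cls_injective q (Quotient.sound' hb)
    rw [h1, h2])

theorem cup_cls {p q : ℕ} (a : Form 𝒢 p) (b : Form 𝒢 q) :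
    cup (cls p a) (cls q b) = cls (p + q) (wedgeForm a b) := rfl

theorem cup_add {p q : ℕ} (a : deRham 𝒢 p) (b b' : deRham 𝒢 q) :
    cup a (b + b') = cup a b + cup a b' := by
  obtain ⟨a, rfl⟩ := cls_surjective p a
  obtain ⟨b, rfl⟩ := cls_surjective q b
  obtain ⟨b', rfl⟩ := cls_surjective q b'
  rw [← map_add, cup_cls, cup_cls, cup_cls, ← map_add]
  exact congrArg _ (Subtype.ext (funext fun x => wedge_add_right _ _ _))

theorem add_cup {p q : ℕ} (a a' : deRham 𝒢 p) (b : deRham 𝒢 q) :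
    cup (a + a') b = cup a b + cup a' b := by
  obtain ⟨a, rfl⟩ := cls_surjective p a
  obtain ⟨a', rfl⟩ := cls_surjective p a'
  obtain ⟨b, rfl⟩ := cls_surjective q b
  rw [← map_add, cup_cls, cup_cls, cup_cls, ← map_add]
  exact congrArg _ (Subtype.ext (funext fun x => wedge_add_left _ _ _))

instance : DirectSum.GNonUnitalNonAssocSemiring (deRham 𝒢) where
  mul := cup
  mul_zero a := by simpa using cup_add a 0 0
  zero_mul b := by simpa using add_cup 0 0 b
  mul_add := cup_add
  add_mul := add_cup

end Cohomology

/-- The total de Rham cohomology `H^*(𝒢, ℂ) = ⨁_p H^p(𝒢, ℂ)`; its multiplication is the cup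
product. -/
abbrev deRhamTotal (𝒢 : Type u) [Groupoid.{v} 𝒢] : Type u := ⨁ p : ℕ, deRham 𝒢 p

/-! ### Pull-back and push-forward -/

section Functoriality

variable {𝒢 : Type u} [Groupoid.{v} 𝒢] {ℋ : Type u} [Groupoid.{v} ℋ] (F : 𝒢 ⥤ ℋ)

/-- Pull-back of invariant forms along a morphism of groupoids (the derivative of `F` is the
unique linear map between zero spaces). -/
def pullForm (p : ℕ) : Form ℋ p →ₗ[ℂ] Form 𝒢 p where
  toFun ω := ⟨fun x => ω.1 (F.obj x), mem_form _ fun _ _ f => form_map ω (F.map f)⟩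
  map_add' _ _ := rfl
  map_smul' _ _ := rfl

/-- Pull-back in cohomology. -/
def pull : deRhamTotal ℋ →ₗ[ℂ] deRhamTotal 𝒢 :=
  DirectSum.lmap fun p => descend ((cls p).comp (pullForm F p))

variable [Finite 𝒢] [∀ x y : 𝒢, Finite (x ⟶ y)] [∀ x y : ℋ, Finite (x ⟶ y)]

/-- Push-forward of forms, by orbifold integration over the (homotopy) fibres of `F`.  The fibre
over `y` is the groupoid of pairs `(x, α : F x ⟶ y)`; orbifold integration of a function over a
finite groupoid weights each isomorphism class of objects by the inverse order of its local group,
which amounts to weighting each object by the inverse of the number of arrows issuing from it. -/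
def pushForm (p : ℕ) : Form 𝒢 p →ₗ[ℂ] Form ℋ p where
  toFun ω := ⟨fun y => ∑ᶠ a : Σ x : 𝒢, (F.obj x ⟶ y),
      (Nat.card (Σ z : 𝒢, (a.1 ⟶ z)) : ℂ)⁻¹ • ω.1 a.1,
    mem_form _ fun y z f => by
      refine (finsum_eq_of_bijective
        (fun a : Σ x : 𝒢, (F.obj x ⟶ y) => (⟨a.1, a.2 ≫ f⟩ : Σ x : 𝒢, (F.obj x ⟶ z)))
        ⟨?_, ?_⟩ ?_).symm
      · rintro ⟨a, g⟩ ⟨b, h⟩ e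
        obtain ⟨rfl, e⟩ := Sigma.mk.inj e
        have e' : g = h := (cancel_mono f).1 (eq_of_heq e)
        rw [e']
      · rintro ⟨a, g⟩
        exact ⟨⟨a, g ≫ Groupoid.inv f⟩, by simp⟩
      · intro a; rfl⟩
  map_add' a b := Subtype.ext (funext fun y => by
    refine Eq.trans (finsum_congr fun x => smul_add _ _ _) ?_
    exact finsum_add_distrib (Set.toFinite _) (Set.toFinite _))
  map_smul' c a := Subtype.ext (funext fun y => by
    refine Eq.trans (finsum_congr fun x => smul_comm _ c _) ?_
    exact (smul_finsum' c (Set.toFinite _)).symm)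

/-- Push-forward in cohomology. -/
def push : deRhamTotal 𝒢 →ₗ[ℂ] deRhamTotal ℋ :=
  DirectSum.lmap fun p => descend ((cls p).comp (pushForm F p))

end Functoriality

/-! ### The obstruction bundle and the Chen–Ruan product -/

/-- The age `∑_θ θ · dim E(θ)` of an automorphism `Φ` of finite order of a complex vector space,
where `E(θ)` is the eigenspace of `Φ` for `exp (2πiθ)`, `θ ∈ ℚ ∩ (0, 1)`.  It is the rank of the
rational combination `∑_θ θ E(θ)`. -/
def age {V : Type w} [AddCommGroup V] [Module ℂ V] (Φ : Module.End ℂ V) : ℚ :=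
  ∑ᶠ θ : Set.Ioo (0 : ℚ) 1, θ.1 *
    (Module.finrank ℂ (Φ.eigenspace (Complex.exp (2 * Real.pi * Complex.I * ((θ.1 : ℚ) : ℂ)))) : ℚ)

section ChenRuanProduct

variable {𝒢 : Type u} [Groupoid.{v} 𝒢]

/-- The degree shifting number `ι` at a point `(x, g)` of the inertia groupoid: the age of the
action of `g` on `T_x 𝒢₀` (on the normal space to the fixed part, the eigenvalue `1` not
contributing). -/
def degreeShift (a : Inertia 𝒢) : ℚ := age (tangentMap (a.loop 0)).toLinearMap

/-- The tangent space to the groupoid of `k`-sectors, as a subspace of `T_x 𝒢₀`: the vectors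
fixed by all of `g₁, …, g_k`. -/
def sectorTangent {k : ℕ} (s : Sector 𝒢 k) : Submodule ℂ Tan :=
  ⨅ i, LinearMap.ker ((tangentMap (s.loop i)).toLinearMap - LinearMap.id)

/-- The rank, at a point `s = (x, g₁, g₂)`, of the obstruction bundle `E`, which is given by
`E = e₁^* 𝒩_Φ + e₂^* 𝒩_Φ + e₁₂^* 𝒩_{Φ⁻¹} - 𝒩` in rational K-theory, `𝒩` being the normal bundle
of the groupoid of `2`-sectors. -/
def obstructionRank (s : Sector 𝒢 2) : ℚ :=
  degreeShift ((e₁ 𝒢).obj s) + degreeShift ((e₂ 𝒢).obj s) + degreeShift (invol ((e₁₂ 𝒢).obj s))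
    - Module.finrank ℂ (Tan ⧸ sectorTangent s)

theorem obstructionRank_congr (s t : Sector 𝒢 2) : obstructionRank s = obstructionRank t := rfl

open Classical in
/-- The Euler class of the obstruction bundle.  The Euler class of a complex vector bundle of rank
`r` lies in degree `2 r`, so in dimension zero it is `1` over the components over which the rank
is `0`, and it is `0` over the others. -/
def eulerForm (𝒢 : Type u) [Groupoid.{v} 𝒢] : Form (Sector 𝒢 2) 0 :=
  ⟨fun s => ContinuousAlternatingMap.constOfIsEmpty ℝ Tan (Fin 0)
      (if obstructionRank s = 0 then (1 : ℂ) else 0),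
    mem_form _ fun s t _ => by rw [obstructionRank_congr s t]⟩

/-- The class `e(E)` in `H^*` of the groupoid of `2`-sectors. -/
def eulerClass (𝒢 : Type u) [Groupoid.{v} 𝒢] : deRhamTotal (Sector 𝒢 2) :=
  DirectSum.of (fun p => deRham (Sector 𝒢 2) p) 0 (cls 0 (eulerForm 𝒢))

end ChenRuanProduct

/-- The underlying vector space of the Chen–Ruan cohomology: the cohomology of the inertia
groupoid.  (A class of degree `p` supported on the sector of `(x, g)` has Chen–Ruan degree
`p + 2 ι(x, g)`; this only changes the grading.) -/
def ChenRuanCohomology (𝒢 : Type u) [Groupoid.{v} 𝒢] : Type (max u v) := deRhamTotal (Inertia 𝒢)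

section ChenRuanRing

variable (𝒢 : Type u) [Groupoid.{v} 𝒢]

instance : AddCommGroup (ChenRuanCohomology 𝒢) :=
  inferInstanceAs (AddCommGroup (deRhamTotal (Inertia 𝒢)))

instance : Module ℂ (ChenRuanCohomology 𝒢) :=
  inferInstanceAs (Module ℂ (deRhamTotal (Inertia 𝒢)))

variable {𝒢} [Finite 𝒢] [∀ x y : 𝒢, Finite (x ⟶ y)]

/-- The Chen–Ruan product
`ω₁ *_CR ω₂ = (e₁₂)_* (e₁^* ω₁ ∪ e₂^* ω₂ ∪ e(E))`. -/
def chenRuanMul (a b : deRhamTotal (Inertia 𝒢)) : deRhamTotal (Inertia 𝒢) :=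
  push (e₁₂ 𝒢) (pull (e₁ 𝒢) a * pull (e₂ 𝒢) b * eulerClass 𝒢)

theorem chenRuanMul_add (a b c : deRhamTotal (Inertia 𝒢)) :
    chenRuanMul a (b + c) = chenRuanMul a b + chenRuanMul a c := by
  simp only [chenRuanMul, map_add, mul_add, add_mul]

theorem add_chenRuanMul (a b c : deRhamTotal (Inertia 𝒢)) :
    chenRuanMul (a + b) c = chenRuanMul a c + chenRuanMul b c := by
  simp only [chenRuanMul, map_add, add_mul]

theorem chenRuanMul_zero (a : deRhamTotal (Inertia 𝒢)) : chenRuanMul a 0 = 0 := by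
  simp only [chenRuanMul, map_zero, zero_mul, mul_zero]

theorem zero_chenRuanMul (a : deRhamTotal (Inertia 𝒢)) : chenRuanMul 0 a = 0 := by
  simp only [chenRuanMul, map_zero, zero_mul]

/-- The Chen–Ruan cohomology with its product. -/
instance : NonUnitalNonAssocRing (ChenRuanCohomology 𝒢) where
  mul := chenRuanMul (𝒢 := 𝒢)
  left_distrib := chenRuanMul_add (𝒢 := 𝒢)
  right_distrib := add_chenRuanMul (𝒢 := 𝒢)
  zero_mul := zero_chenRuanMul (𝒢 := 𝒢)
  mul_zero := chenRuanMul_zero (𝒢 := 𝒢)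

end ChenRuanRing

/-! ### Quotient orbifolds by finite groups -/

/-- The objects of the action groupoid `X ⋊ G`. -/
structure ActionGroupoid (G : Type u) (X : Type u) where
  pt : X

/-- The action groupoid `X ⋊ G` presenting `[X/G]`: the arrow `(x, g)` leads from `x` to
`g⁻¹ • x`, and `(x, g) · (g⁻¹ • x, h) = (x, g h)`. -/
instance (G X : Type u) [Group G] [MulAction G X] : Groupoid.{u} (ActionGroupoid G X) where
  Hom x y := {g : G // g • y.pt = x.pt}
  id x := ⟨1, one_smul G x.pt⟩
  comp f g := ⟨f.1 * g.1, by rw [mul_smul, g.2, f.2]⟩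
  inv f := ⟨f.1⁻¹, inv_smul_eq_iff.2 f.2.symm⟩
  id_comp f := Subtype.ext (one_mul f.1)
  comp_id f := Subtype.ext (mul_one f.1)
  assoc f g h := Subtype.ext (mul_assoc f.1 g.1 h.1)
  inv_comp f := Subtype.ext (inv_mul_cancel f.1)
  comp_inv f := Subtype.ext (mul_inv_cancel f.1)

instance (G X : Type u) [Finite X] : Finite (ActionGroupoid G X) :=
  Finite.of_injective (fun x => x.pt) (by rintro ⟨x⟩ ⟨y⟩ h; cases h; rfl)

instance (G X : Type u) [Group G] [MulAction G X] [Finite G] (x y : ActionGroupoid G X) :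
    Finite (x ⟶ y) :=
  inferInstanceAs (Finite {g : G // g • y.pt = x.pt})

instance (G : Type u) [Finite G] : Finite (ConjAct G) := inferInstanceAs (Finite G)

/-- The groupoid presenting the orbifold `[G/G]`: `G` acting on itself by conjugation. -/
abbrev ConjGroupoid (G : Type u) [Group G] := ActionGroupoid (ConjAct G) G

/-! ### Invariant functions on commuting pairs -/

section CommutingPairs

/-- The set `G̃` of commuting pairs in `G`. -/
def CommPair (G : Type u) [Group G] : Type u := {p : G × G // p.1 * p.2 = p.2 * p.1}

variable (G : Type u) [Group G]

/-- Simultaneous conjugation on commuting pairs. -/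
def CommPair.conj {G : Type u} [Group G] (k : G) (p : CommPair G) : CommPair G :=
  ⟨(k * p.1.1 * k⁻¹, k * p.1.2 * k⁻¹), by
    have h := p.2
    show k * p.1.1 * k⁻¹ * (k * p.1.2 * k⁻¹) = k * p.1.2 * k⁻¹ * (k * p.1.1 * k⁻¹)
    calc _ = k * (p.1.1 * p.1.2) * k⁻¹ := by group
      _ = k * (p.1.2 * p.1.1) * k⁻¹ := by rw [h]
      _ = _ := by group⟩

/-- The commuting pair `(g, h)` for `h` in the centralizer `Z_G(g)`. -/
def CommPair.mk' {G : Type u} [Group G] (g : G) (h : Subgroup.centralizer {g}) : CommPair G :=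
  ⟨(g, h.1), Subgroup.mem_centralizer_iff.1 h.2 g rfl⟩

/-- The `G`-invariant complex-valued functions on `G̃`, as a subspace of all functions. -/
def invariantSubmodule : Submodule ℂ (CommPair G → ℂ) where
  carrier := {f | ∀ (k : G) (p : CommPair G), f (p.conj k) = f p}
  zero_mem' _ _ := rfl
  add_mem' ha hb k p := by rw [Pi.add_apply, Pi.add_apply, ha k p, hb k p]
  smul_mem' c _ ha k p := by rw [Pi.smul_apply, Pi.smul_apply, ha k p]

/-- The vector space of `G`-invariant functions on `G̃`. -/
def InvariantFun : Type u := invariantSubmodule G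

instance : AddCommGroup (InvariantFun G) := inferInstanceAs (AddCommGroup (invariantSubmodule G))

instance : Module ℂ (InvariantFun G) := inferInstanceAs (Module ℂ (invariantSubmodule G))

instance : FunLike (InvariantFun G) (CommPair G) ℂ where
  coe f := f.1
  coe_injective _ _ h := Subtype.ext h

variable {G}

theorem InvariantFun.apply_conj (f : InvariantFun G) (k : G) (p : CommPair G) :
    f (p.conj k) = f p := f.2 k p

theorem InvariantFun.add_apply (f₁ f₂ : InvariantFun G) (p : CommPair G) :
    (f₁ + f₂) p = f₁ p + f₂ p := rfl

/-- The pairs `(h₁, h₂)` of elements of `Z_G(g)` with `h₁ h₂ = h`. -/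
abbrev Factorization (g h : G) : Type u :=
  {q : Subgroup.centralizer {g} × Subgroup.centralizer {g} // (q.1 * q.2 : G) = h}

/-- The function `(g, h) ↦ ∑_{h₁, h₂ ∈ Z_G(g), h₁ h₂ = h} f₁ (g, h₁) f₂ (g, h₂)`. -/
def starFun (f₁ f₂ : CommPair G → ℂ) (p : CommPair G) : ℂ :=
  ∑ᶠ q : Factorization p.1.1 p.1.2,
    f₁ (CommPair.mk' p.1.1 q.1.1) * f₂ (CommPair.mk' p.1.1 q.1.2)

/-- Conjugation as an equivalence between centralizers. -/
def conjCentralizer (k g : G) :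
    Subgroup.centralizer {g} ≃ Subgroup.centralizer {k * g * k⁻¹} where
  toFun h := ⟨k * h.1 * k⁻¹, Subgroup.mem_centralizer_iff.2 (by
    rintro _ rfl
    have := Subgroup.mem_centralizer_iff.1 h.2 g rfl
    calc _ = k * (g * h.1) * k⁻¹ := by group
      _ = k * (h.1 * g) * k⁻¹ := by rw [this]
      _ = _ := by group)⟩
  invFun h := ⟨k⁻¹ * h.1 * k, Subgroup.mem_centralizer_iff.2 (by
    rintro _ rfl
    have := Subgroup.mem_centralizer_iff.1 h.2 _ rfl
    rename_i y
    calc _ = k⁻¹ * ((k * y * k⁻¹) * h.1) * k := by group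
      _ = k⁻¹ * (h.1 * (k * y * k⁻¹)) * k := by rw [this]
      _ = _ := by group)⟩
  left_inv h := Subtype.ext (by simp [mul_assoc])
  right_inv h := Subtype.ext (by simp [mul_assoc])

theorem conj_mk' (k g : G) (h : Subgroup.centralizer {g}) :
    (CommPair.mk' g h).conj k = CommPair.mk' (k * g * k⁻¹) (conjCentralizer k g h) := rfl

/-- The product `*₂`: convolution in the second variable over the centralizer of the first. -/
def InvariantFun.star (f₁ f₂ : InvariantFun G) : InvariantFun G :=
  ⟨starFun f₁ f₂, fun k p => by
    symm
    refine finsum_eq_of_bijective (fun q : Factorization p.1.1 p.1.2 =>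
      (⟨(conjCentralizer k _ q.1.1, conjCentralizer k _ q.1.2), by
        show k * q.1.1.1 * k⁻¹ * (k * q.1.2.1 * k⁻¹) = k * p.1.2 * k⁻¹
        have h : q.1.1.1 * q.1.2.1 = p.1.2 := q.2
        calc _ = k * (q.1.1.1 * q.1.2.1) * k⁻¹ := by group
          _ = _ := by rw [h]⟩ : Factorization (p.conj k).1.1 (p.conj k).1.2)) ⟨?_, ?_⟩ ?_
    · rintro ⟨⟨a, b⟩, h⟩ ⟨⟨a', b'⟩, h'⟩ e
      have e1 := congrArg (fun q => q.1.1) e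
      have e2 := congrArg (fun q => q.1.2) e
      have e1' := (conjCentralizer k _).injective e1
      have e2' := (conjCentralizer k _).injective e2
      exact Subtype.ext (Prod.ext e1' e2')
    · rintro ⟨⟨a, b⟩, h⟩
      refine ⟨⟨((conjCentralizer k _).symm a, (conjCentralizer k _).symm b), ?_⟩, ?_⟩
      · show k⁻¹ * a.1 * k * (k⁻¹ * b.1 * k) = p.1.2
        have h' : a.1 * b.1 = k * p.1.2 * k⁻¹ := h
        calc _ = k⁻¹ * (a.1 * b.1) * k := by group
          _ = _ := by rw [h']; group
      · exact Subtype.ext (Prod.ext ((conjCentralizer k _).apply_symm_apply a)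
          ((conjCentralizer k _).apply_symm_apply b))
    · intro q
      rw [← f₁.apply_conj k, ← f₂.apply_conj k]; rfl⟩

instance : Mul (InvariantFun G) := ⟨InvariantFun.star⟩

theorem InvariantFun.mul_apply (f₁ f₂ : InvariantFun G) (p : CommPair G) :
    (f₁ * f₂) p = ∑ᶠ q : Factorization p.1.1 p.1.2,
      f₁ (CommPair.mk' p.1.1 q.1.1) * f₂ (CommPair.mk' p.1.1 q.1.2) := rfl

theorem InvariantFun.ext_mk' {f₁ f₂ : InvariantFun G}
    (h : ∀ (g : G) (a : Subgroup.centralizer {g}),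
      f₁ (CommPair.mk' g a) = f₂ (CommPair.mk' g a)) : f₁ = f₂ :=
  DFunLike.ext _ _ fun p => h p.1.1 ⟨p.1.2, Subgroup.mem_centralizer_iff.2 (by
    rintro _ rfl; exact p.2)⟩

theorem InvariantFun.mul_mk' (f₁ f₂ : InvariantFun G) (g : G) (a : Subgroup.centralizer {g}) :
    (f₁ * f₂) (CommPair.mk' g a) = ∑ᶠ b : Subgroup.centralizer {g},
      f₁ (CommPair.mk' g b) * f₂ (CommPair.mk' g (b⁻¹ * a)) := by
  rw [InvariantFun.mul_apply]
  refine finsum_eq_of_bijective (fun q => q.1.1) ⟨?_, ?_⟩ ?_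
  · rintro ⟨⟨b, c⟩, h⟩ ⟨⟨b', c'⟩, h'⟩ e
    obtain rfl : b = b' := e
    have : c = c' := Subtype.ext (mul_left_cancel (h.trans h'.symm))
    subst this
    rfl
  · intro b
    exact ⟨⟨(b, b⁻¹ * a), by
      show b.1 * (b.1⁻¹ * a.1) = a.1
      rw [mul_inv_cancel_left]⟩, rfl⟩
  · rintro ⟨⟨b, c⟩, h⟩
    have key : ∀ b c : Subgroup.centralizer {g}, (b * c : G) = a → c = b⁻¹ * a := fun b c h => by
      rw [eq_inv_mul_iff_mul_eq]
      exact Subtype.ext h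
    obtain rfl := key b c h
    rfl

open Classical in
instance : One (InvariantFun G) :=
  ⟨⟨fun p => if p.1.2 = 1 then 1 else 0, fun k p => by
    have : k * p.1.2 * k⁻¹ = 1 ↔ p.1.2 = 1 := by
      rw [mul_inv_eq_one, mul_eq_left]
    show (if k * p.1.2 * k⁻¹ = 1 then (1 : ℂ) else 0) = _
    simp only [this]⟩⟩

open Classical in
theorem InvariantFun.one_mk' (g : G) (a : Subgroup.centralizer {g}) :
    (1 : InvariantFun G) (CommPair.mk' g a) = if a = 1 then 1 else 0 := by
  show (if a.1 = 1 then (1 : ℂ) else 0) = _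
  simp

/-- The ring of `G`-invariant functions on `G̃` with the product `*₂`. -/
instance [Finite G] : Ring (InvariantFun G) where
  zero_mul f := InvariantFun.ext_mk' fun g a => by
    rw [InvariantFun.mul_mk']
    exact (finsum_congr fun b => zero_mul _).trans finsum_zero
  mul_zero f := InvariantFun.ext_mk' fun g a => by
    rw [InvariantFun.mul_mk']
    exact (finsum_congr fun b => mul_zero _).trans finsum_zero
  left_distrib f₁ f₂ f₃ := InvariantFun.ext_mk' fun g a => by
    simp only [InvariantFun.mul_mk', InvariantFun.add_apply, mul_add]
    exact finsum_add_distrib (Set.toFinite _) (Set.toFinite _)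
  right_distrib f₁ f₂ f₃ := InvariantFun.ext_mk' fun g a => by
    simp only [InvariantFun.mul_mk', InvariantFun.add_apply, add_mul]
    exact finsum_add_distrib (Set.toFinite _) (Set.toFinite _)
  one_mul f := InvariantFun.ext_mk' fun g a => by
    rw [InvariantFun.mul_mk', finsum_eq_single _ 1]
    · simp [InvariantFun.one_mk']
    · intro b hb
      simp [InvariantFun.one_mk', hb]
  mul_one f := InvariantFun.ext_mk' fun g a => by
    rw [InvariantFun.mul_mk', finsum_eq_single _ a]
    · simp [InvariantFun.one_mk']
    · intro b hb
      simp [InvariantFun.one_mk', inv_mul_eq_one, hb]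
  mul_assoc f₁ f₂ f₃ := InvariantFun.ext_mk' fun g a => by
    have := Fintype.ofFinite (Subgroup.centralizer {g})
    simp only [InvariantFun.mul_mk', finsum_eq_sum_of_fintype, Finset.sum_mul, Finset.mul_sum]
    rw [Finset.sum_comm]
    refine Finset.sum_congr rfl fun b _ => ?_
    refine Fintype.sum_equiv (Equiv.mulLeft b⁻¹) _ _ fun c => ?_
    simp [mul_assoc]
  neg_add_cancel := neg_add_cancel
  zsmul := fun n f => n • f
  nsmul := fun n f => n • f
  nsmul_zero := zero_nsmul
  nsmul_succ := fun n f => succ_nsmul f n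
  zsmul_zero' := zero_zsmul
  zsmul_succ' := SubNegMonoid.zsmul_succ'
  zsmul_neg' := SubNegMonoid.zsmul_neg'
  sub_eq_add_neg := sub_eq_add_neg

end CommutingPairs

end ChenRuan

end

/-!
In dimension zero a form of positive degree vanishes, so a cohomology class is a function on the
objects which is constant along arrows.  In these terms the cup product is pointwise, pull-back is
composition and the obstruction bundle has rank zero.  A point of the homotopy fibre of `e₁₂` over
`(x, g)` amounts to an arrow ending in `x` together with a factorization `g = g₁ g₂`; the weights of
orbifold integration average over the arrow and leave the sum over the factorizations, so the
Chen–Ruan product is the convolution of functions on loops.  For `[G/G]` the loops at `g` form the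
centralizer of `g`, and this convolution is `*₂`.
-/

noncomputable section

namespace ChenRuan

universe u v w

/-! ### Values of cohomology classes -/

open scoped TensorProduct in
theorem domCoprod_apply_of_isEmpty {R M N₁ N₂ ι₁ ι₂ : Type*} [CommSemiring R]
    [AddCommMonoid M] [Module R M] [AddCommGroup N₁] [Module R N₁] [AddCommGroup N₂] [Module R N₂]
    [Fintype ι₁] [DecidableEq ι₁] [IsEmpty ι₁] [Fintype ι₂] [DecidableEq ι₂] [IsEmpty ι₂]
    (a : M [⋀^ι₁]→ₗ[R] N₁) (b : M [⋀^ι₂]→ₗ[R] N₂) (v : ι₁ ⊕ ι₂ → M) :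
    a.domCoprod b v = a (v ∘ Sum.inl) ⊗ₜ[R] b (v ∘ Sum.inr) := by
  have : Subsingleton (Equiv.Perm.ModSumCongr ι₁ ι₂) := Quotient.mk''_surjective.subsingleton
  have sum_eq : ∑ σ, AlternatingMap.domCoprod.summand a b σ =
      AlternatingMap.domCoprod.summand a b (Quotient.mk'' 1) :=
    Fintype.sum_subsingleton _ _
  rw [← AlternatingMap.coe_multilinearMap, AlternatingMap.domCoprod_coe, sum_eq,
    AlternatingMap.domCoprod.summand_mk'', Equiv.Perm.sign_one, one_smul]
  rfl

theorem wedge_zero_apply (a b : Tan [⋀^Fin 0]→L[ℝ] ℂ) : wedge a b 0 = a 0 * b 0 := by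
  have domCoprod_eq := domCoprod_apply_of_isEmpty a.toAlternatingMap b.toAlternatingMap
    ((0 : Fin 0 → Tan) ∘ finSumFinEquiv)
  exact (congrArg (LinearMap.mul' ℝ ℂ) domCoprod_eq).trans (LinearMap.mul'_apply ..)

theorem lof_surjective_of_subsingleton {R ι : Type*} [Semiring R] [DecidableEq ι] {M : ι → Type*}
    [∀ i, AddCommMonoid (M i)] [∀ i, Module R (M i)] {i : ι}
    (h : ∀ j, j ≠ i → Subsingleton (M j)) : Function.Surjective (DirectSum.lof R ι M i) := by
  refine fun a => ⟨a i, DFinsupp.ext fun j => ?_⟩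
  obtain rfl | hj := eq_or_ne j i
  · exact DirectSum.of_eq_same j (a j)
  · exact (h j hj).elim _ _

section Value

variable {𝒢 : Type u} [Groupoid.{v} 𝒢] {ℋ : Type u} [Groupoid.{v} ℋ]

/-- Evaluation of an invariant form of degree zero at a point. -/
def formValue (x : 𝒢) : Form 𝒢 0 →ₗ[ℂ] ℂ where
  toFun ω := ω.1 x 0
  map_add' _ _ := rfl
  map_smul' _ _ := rfl

theorem formValue_ext {ω η : Form 𝒢 0} (h : ∀ x, formValue x ω = formValue x η) : ω = η :=
  Subtype.ext <| funext fun x => ContinuousAlternatingMap.ext fun m => by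
    rw [Subsingleton.elim m 0]
    exact h x

theorem formValue_map (ω : Form 𝒢 0) {x y : 𝒢} (f : x ⟶ y) : formValue y ω = formValue x ω :=
  congrArg (fun a : Tan [⋀^Fin 0]→L[ℝ] ℂ => a 0) (form_map ω f)

theorem formValue_pushForm (F : 𝒢 ⥤ ℋ) [Finite 𝒢] [∀ x y : 𝒢, Finite (x ⟶ y)]
    [∀ x y : ℋ, Finite (x ⟶ y)] (y : ℋ) (ω : Form 𝒢 0) :
    formValue y (pushForm F 0 ω) = ∑ᶠ c : Σ x : 𝒢, (F.obj x ⟶ y),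
      (Nat.card (Quiver.Star c.1) : ℂ)⁻¹ * formValue c.1 ω :=
  AddMonoidHom.map_finsum
    { toFun := fun a : Tan [⋀^Fin 0]→L[ℝ] ℂ => a 0, map_zero' := rfl, map_add' := fun _ _ => rfl }
    (Set.toFinite _)

/-- The class in the total cohomology of an invariant form of degree zero. -/
def zeroClass : Form 𝒢 0 →ₗ[ℂ] deRhamTotal 𝒢 :=
  DirectSum.lof ℂ ℕ (deRham 𝒢) 0 ∘ₗ cls 0

theorem zeroClass_surjective : Function.Surjective (zeroClass (𝒢 := 𝒢)) := by
  refine (lof_surjective_of_subsingleton (R := ℂ) (M := deRham 𝒢) fun p hp => ?_).comp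
    (cls_surjective 0)
  obtain ⟨p, rfl⟩ := Nat.exists_eq_succ_of_ne_zero hp
  exact (cls_surjective (p + 1)).subsingleton

theorem zeroClass_mul (ω η : Form 𝒢 0) :
    zeroClass ω * zeroClass η = zeroClass (wedgeForm ω η : Form 𝒢 0) :=
  DirectSum.of_mul_of _ _

theorem pull_zeroClass (F : 𝒢 ⥤ ℋ) (ω : Form ℋ 0) :
    pull F (zeroClass ω) = zeroClass (pullForm F 0 ω) :=
  DirectSum.lmap_lof (fun p => descend ((cls p).comp (pullForm F p))) 0 (cls 0 ω)

theorem push_zeroClass (F : 𝒢 ⥤ ℋ) [Finite 𝒢] [∀ x y : 𝒢, Finite (x ⟶ y)]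
    [∀ x y : ℋ, Finite (x ⟶ y)] (ω : Form 𝒢 0) :
    push F (zeroClass ω) = zeroClass (pushForm F 0 ω) :=
  DirectSum.lmap_lof (fun p => descend ((cls p).comp (pushForm F p))) 0 (cls 0 ω)

/-- A cohomology class as a function on the objects: the values of its component of degree zero,
which is a locally constant function. -/
def value : deRhamTotal 𝒢 →ₗ[ℂ] 𝒢 → ℂ :=
  LinearMap.pi fun x => descend (formValue x) ∘ₗ DirectSum.component ℂ ℕ (deRham 𝒢) 0

theorem value_zeroClass (ω : Form 𝒢 0) (x : 𝒢) : value (zeroClass ω) x = formValue x ω :=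
  congrArg (descend (formValue x)) (DirectSum.component.lof_self ℂ 0 (cls 0 ω))

theorem value_injective : Function.Injective (value (𝒢 := 𝒢)) := by
  intro a b h
  obtain ⟨ω, rfl⟩ := zeroClass_surjective a
  obtain ⟨η, rfl⟩ := zeroClass_surjective b
  have formValue_eq (x : 𝒢) : formValue x ω = formValue x η := by
    simpa only [value_zeroClass] using congrFun h x
  rw [formValue_ext formValue_eq]

theorem exists_value_eq {f : 𝒢 → ℂ} (hf : ∀ x y : 𝒢, (x ⟶ y) → f y = f x) :
    ∃ a : deRhamTotal 𝒢, value a = f :=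
  ⟨zeroClass ⟨fun x => ContinuousAlternatingMap.constOfIsEmpty ℝ Tan (Fin 0) (f x),
    mem_form _ fun x y k => by rw [hf x y k]⟩, funext fun x => value_zeroClass _ x⟩

theorem value_map (a : deRhamTotal 𝒢) {x y : 𝒢} (f : x ⟶ y) : value a y = value a x := by
  obtain ⟨ω, rfl⟩ := zeroClass_surjective a
  rw [value_zeroClass, value_zeroClass, formValue_map ω f]

theorem value_mul (a b : deRhamTotal 𝒢) : value (a * b) = value a * value b := by
  obtain ⟨ω, rfl⟩ := zeroClass_surjective a
  obtain ⟨η, rfl⟩ := zeroClass_surjective b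
  ext x
  rw [zeroClass_mul, Pi.mul_apply, value_zeroClass, value_zeroClass, value_zeroClass]
  exact wedge_zero_apply (ω.1 x) (η.1 x)

theorem value_pull (F : 𝒢 ⥤ ℋ) (a : deRhamTotal ℋ) (x : 𝒢) :
    value (pull F a) x = value a (F.obj x) := by
  obtain ⟨ω, rfl⟩ := zeroClass_surjective a
  rw [pull_zeroClass, value_zeroClass, value_zeroClass]
  rfl

theorem value_push (F : 𝒢 ⥤ ℋ) [Finite 𝒢] [∀ x y : 𝒢, Finite (x ⟶ y)]
    [∀ x y : ℋ, Finite (x ⟶ y)] (a : deRhamTotal 𝒢) (y : ℋ) :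
    value (push F a) y = ∑ᶠ c : Σ x : 𝒢, (F.obj x ⟶ y),
      (Nat.card (Quiver.Star c.1) : ℂ)⁻¹ * value a c.1 := by
  obtain ⟨ω, rfl⟩ := zeroClass_surjective a
  simp only [push_zeroClass, value_zeroClass, formValue_pushForm]

end Value

/-! ### The obstruction bundle -/

theorem age_of_subsingleton {V : Type w} [AddCommGroup V] [Module ℂ V] [Subsingleton V]
    (Φ : Module.End ℂ V) : age Φ = 0 := by
  refine (finsum_congr fun θ => ?_).trans finsum_zero
  rw [Module.finrank_zero_of_subsingleton, Nat.cast_zero, mul_zero]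

section Obstruction

variable {𝒢 : Type u} [Groupoid.{v} 𝒢]

theorem obstructionRank_eq_zero (s : Sector 𝒢 2) : obstructionRank s = 0 := by
  have : Subsingleton (Tan ⧸ sectorTangent s) := (Submodule.mkQ_surjective _).subsingleton
  simp only [obstructionRank, degreeShift, age_of_subsingleton,
    Module.finrank_zero_of_subsingleton, add_zero, Nat.cast_zero, sub_zero]

theorem value_eulerClass : value (eulerClass 𝒢) = 1 :=
  funext fun s => (value_zeroClass (eulerForm 𝒢) s).trans (if_pos (obstructionRank_eq_zero s))

end Obstruction

/-! ### The Chen–Ruan product as a convolution -/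

theorem finsum_prod_inv_card_mul {α β K : Type*} [Finite α] [Nonempty α] [Finite β] [DivisionRing K]
    [CharZero K] (φ : β → K) : ∑ᶠ d : α × β, (Nat.card α : K)⁻¹ * φ d.2 = ∑ᶠ b, φ b := by
  have := Fintype.ofFinite α
  have := Fintype.ofFinite β
  have card_ne_zero : (Nat.card α : K) ≠ 0 := Nat.cast_ne_zero.2 Nat.card_pos.ne'
  rw [finsum_eq_sum_of_fintype, finsum_eq_sum_of_fintype, Fintype.sum_prod_type]
  simp only [← Finset.mul_sum, Finset.sum_const, Finset.card_univ, ← Nat.card_eq_fintype_card,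
    nsmul_eq_mul, inv_mul_cancel_left₀ card_ne_zero]

section Convolution

variable {𝒢 : Type u} [Groupoid.{v} 𝒢]

theorem card_star_eq_card_costar {x y : 𝒢} (f : x ⟶ y) :
    Nat.card (Quiver.Star x) = Nat.card (Quiver.Costar y) :=
  Nat.card_congr <| Equiv.sigmaCongrRight fun z =>
    { toFun := fun g => Groupoid.inv g ≫ f
      invFun := fun g => f ≫ Groupoid.inv g
      left_inv := fun g => by simp
      right_inv := fun g => by simp }

/-- The arrows issuing from a multi-sector are those issuing from the underlying point. -/
def sectorStarEquiv {k : ℕ} (s : Sector 𝒢 k) : Quiver.Star s ≃ Quiver.Star s.pt where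
  toFun a := ⟨a.1.pt, a.2.1⟩
  invFun a := ⟨⟨a.1, fun i => Groupoid.inv a.2 ≫ s.loop i ≫ a.2⟩, ⟨a.2, fun _ => rfl⟩⟩
  left_inv := by
    rintro ⟨⟨x, l⟩, ⟨(f : s.pt ⟶ x), h⟩⟩
    obtain rfl : l = fun i => Groupoid.inv f ≫ s.loop i ≫ f := funext h
    rfl
  right_inv _ := rfl

/-- Conjugation of loops along an arrow `f`, namely `g ↦ f⁻¹ g f` as in the groupoids of
multi-sectors. -/
def conjLoop {x y : 𝒢} (f : x ⟶ y) : (x ⟶ x) ≃ (y ⟶ y) where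
  toFun g := Groupoid.inv f ≫ g ≫ f
  invFun g := f ≫ g ≫ Groupoid.inv f
  left_inv g := by simp
  right_inv g := by simp

theorem conjLoop_comp {x y : 𝒢} (f : x ⟶ y) (g h : x ⟶ x) :
    conjLoop f (g ≫ h) = conjLoop f g ≫ conjLoop f h := by
  simp [conjLoop]

/-- The point `(x, g)` of the inertia groupoid. -/
def inertiaPoint {x : 𝒢} (g : x ⟶ x) : Inertia 𝒢 := ⟨x, fun _ => g⟩

/-- The factorizations `g = g₁ g₂` of a loop into two loops. -/
abbrev LoopFactorization {x : 𝒢} (g : x ⟶ x) : Type v :=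
  {q : (x ⟶ x) × (x ⟶ x) // q.1 ≫ q.2 = g}

theorem value_conjLoop (a : deRhamTotal (Inertia 𝒢)) {x y : 𝒢} (f : x ⟶ y) (g : x ⟶ x) :
    value a (inertiaPoint (conjLoop f g)) = value a (inertiaPoint g) :=
  value_map a (show inertiaPoint g ⟶ inertiaPoint (conjLoop f g) from ⟨f, fun _ => rfl⟩)

theorem e₁₂Fibre_ext {x z : 𝒢} {g : x ⟶ x} {l l' : Fin 2 → (z ⟶ z)}
    {f : (e₁₂ 𝒢).obj ⟨z, l⟩ ⟶ inertiaPoint g} {f' : (e₁₂ 𝒢).obj ⟨z, l'⟩ ⟶ inertiaPoint g}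
    (hl : l = l') (hf : f.1 = f'.1) :
    (⟨⟨z, l⟩, f⟩ : Σ s : Sector 𝒢 2, ((e₁₂ 𝒢).obj s ⟶ inertiaPoint g)) = ⟨⟨z, l'⟩, f'⟩ := by
  subst hl
  exact congrArg (Sigma.mk _) (Subtype.ext hf)

/-- The homotopy fibre of `e₁₂` over `(x, g)`: a `2`-sector `(z, g₁, g₂)` with an arrow `f : z ⟶ x`
is recovered from `f` and the factorization of `g` obtained by conjugating `g₁` and `g₂` along
`f`. -/
def e₁₂FibreEquiv {x : 𝒢} (g : x ⟶ x) :
    (Σ s : Sector 𝒢 2, ((e₁₂ 𝒢).obj s ⟶ inertiaPoint g)) ≃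
      Quiver.Costar x × LoopFactorization g where
  toFun c := (⟨c.1.pt, c.2.1⟩, ⟨(conjLoop c.2.1 (c.1.loop 0), conjLoop c.2.1 (c.1.loop 1)),
    (conjLoop_comp _ _ _).symm.trans (c.2.2 0).symm⟩)
  invFun d := ⟨⟨d.1.1, ![(conjLoop d.1.2).symm d.2.1.1, (conjLoop d.1.2).symm d.2.1.2]⟩,
    ⟨d.1.2, fun _ => d.2.2.symm.trans <| .symm <| (conjLoop_comp _ _ _).trans <|
      congrArg₂ _ ((conjLoop d.1.2).apply_symm_apply _) ((conjLoop d.1.2).apply_symm_apply _)⟩⟩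
  left_inv := by
    rintro ⟨⟨z, l⟩, ⟨(f : z ⟶ x), h⟩⟩
    refine e₁₂Fibre_ext (funext fun i => ?_) rfl
    fin_cases i <;> exact (conjLoop f).symm_apply_apply _
  right_inv := by
    rintro ⟨⟨z, f⟩, ⟨⟨g₁, g₂⟩, h⟩⟩
    exact Prod.ext rfl <| Subtype.ext <|
      Prod.ext ((conjLoop f).apply_symm_apply g₁) ((conjLoop f).apply_symm_apply g₂)

variable [Finite 𝒢] [∀ x y : 𝒢, Finite (x ⟶ y)]

theorem value_chenRuanMul (a b : deRhamTotal (Inertia 𝒢)) {x : 𝒢} (g : x ⟶ x) :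
    value (chenRuanMul a b) (inertiaPoint g) = ∑ᶠ q : LoopFactorization g,
      value a (inertiaPoint q.1.1) * value b (inertiaPoint q.1.2) := by
  have : Nonempty (Quiver.Costar x) := ⟨⟨x, 𝟙 x⟩⟩
  let convolutionTerm (q : LoopFactorization g) : ℂ :=
    value a (inertiaPoint q.1.1) * value b (inertiaPoint q.1.2)
  have card_star (c : Σ s : Sector 𝒢 2, ((e₁₂ 𝒢).obj s ⟶ inertiaPoint g)) :
      Nat.card (Quiver.Star c.1) = Nat.card (Quiver.Costar x) :=
    (Nat.card_congr (sectorStarEquiv c.1)).trans (card_star_eq_card_costar c.2.1)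
  have value_integrand (c : Σ s : Sector 𝒢 2, ((e₁₂ 𝒢).obj s ⟶ inertiaPoint g)) :
      value (pull (e₁ 𝒢) a * pull (e₂ 𝒢) b * eulerClass 𝒢) c.1 =
        convolutionTerm (e₁₂FibreEquiv g c).2 := by
    rw [value_mul, value_eulerClass, mul_one, value_mul, Pi.mul_apply, value_pull, value_pull]
    exact congrArg₂ _ (value_conjLoop a c.2.1 (c.1.loop 0)).symm
      (value_conjLoop b c.2.1 (c.1.loop 1)).symm
  calc value (chenRuanMul a b) (inertiaPoint g)
    _ = ∑ᶠ c, (Nat.card (Quiver.Costar x) : ℂ)⁻¹ * convolutionTerm (e₁₂FibreEquiv g c).2 := by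
      simp only [chenRuanMul, value_push, card_star, value_integrand]
    _ = ∑ᶠ d : Quiver.Costar x × LoopFactorization g,
          (Nat.card (Quiver.Costar x) : ℂ)⁻¹ * convolutionTerm d.2 :=
      finsum_comp_equiv (e₁₂FibreEquiv g)
        (f := fun d => (Nat.card (Quiver.Costar x) : ℂ)⁻¹ * convolutionTerm d.2)
    _ = ∑ᶠ q, convolutionTerm q := finsum_prod_inv_card_mul convolutionTerm

end Convolution

/-! ### The orbifold `[G/G]` -/

section ConjugationQuotient

variable {G : Type u} [Group G]

theorem conjAct_smul_eq_self_iff (k : ConjAct G) (g : G) :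
    k • g = g ↔ ConjAct.ofConjAct k ∈ Subgroup.centralizer {g} := by
  rw [ConjAct.smul_def, mul_inv_eq_iff_eq_mul, Subgroup.mem_centralizer_singleton_iff]

/-- The loops at `g` in the groupoid presenting `[G/G]` form the centralizer of `g`. -/
def loopEquivCentralizer (g : G) :
    ((⟨g⟩ : ConjGroupoid G) ⟶ ⟨g⟩) ≃ Subgroup.centralizer {g} :=
  ConjAct.ofConjAct.toEquiv.subtypeEquiv fun k => conjAct_smul_eq_self_iff k g

/-- The factorizations of a loop are the factorizations in the centralizer over which `*₂` sums. -/
def loopFactorizationEquiv (g : G) (h : Subgroup.centralizer {g}) :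
    LoopFactorization ((loopEquivCentralizer g).symm h) ≃ Factorization g h.1 :=
  ((loopEquivCentralizer g).prodCongr (loopEquivCentralizer g)).subtypeEquiv
    fun _ => Subtype.ext_iff

/-- Commuting pairs as the objects of the inertia groupoid of `[G/G]`. -/
def commPairEquivInertia : CommPair G ≃ Inertia (ConjGroupoid G) where
  toFun p := inertiaPoint <| (loopEquivCentralizer p.1.1).symm
    ⟨p.1.2, Subgroup.mem_centralizer_singleton_iff.2 p.2.symm⟩
  invFun a := CommPair.mk' a.pt.pt (loopEquivCentralizer a.pt.pt (a.loop 0))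
  left_inv _ := rfl
  right_inv a := congrArg (Sector.mk a.pt) <| funext fun i =>
    congrArg a.loop (Subsingleton.elim 0 i)

theorem commPairEquivInertia_mk' (g : G) (h : Subgroup.centralizer {g}) :
    commPairEquivInertia (CommPair.mk' g h) = inertiaPoint ((loopEquivCentralizer g).symm h) :=
  rfl

/-- Conjugation of commuting pairs by `k` as an arrow of the inertia groupoid. -/
def conjArrow (k : G) (p : CommPair G) :
    commPairEquivInertia (p.conj k) ⟶ commPairEquivInertia p :=
  ⟨⟨ConjAct.toConjAct k, ConjAct.toConjAct_smul _ _⟩, fun _ => Subtype.ext <|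
    show p.1.2 = k⁻¹ * (k * p.1.2 * k⁻¹ * k) by group⟩

theorem exists_eq_conj_of_hom {x y : Inertia (ConjGroupoid G)} (f : x ⟶ y) :
    ∃ k : G, commPairEquivInertia.symm x = (commPairEquivInertia.symm y).conj k := by
  let k : G := ConjAct.ofConjAct f.1.1
  have pt_eq : k * y.pt.pt * k⁻¹ = x.pt.pt := f.1.2
  have loop_eq : ConjAct.ofConjAct (y.loop 0).1 = k⁻¹ * (ConjAct.ofConjAct (x.loop 0).1 * k) :=
    congrArg Subtype.val (f.2 0)
  refine ⟨k, Subtype.ext (Prod.ext pt_eq.symm ?_)⟩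
  change ConjAct.ofConjAct (x.loop 0).1 = k * ConjAct.ofConjAct (y.loop 0).1 * k⁻¹
  rw [loop_eq]
  group

/-- The invariant function on commuting pairs given by the values of a class. -/
def toInvariantFun : deRhamTotal (Inertia (ConjGroupoid G)) →ₗ[ℂ] InvariantFun G where
  toFun a := ⟨value a ∘ commPairEquivInertia, fun k p => (value_map a (conjArrow k p)).symm⟩
  map_add' a b := Subtype.ext <| congrArg (· ∘ commPairEquivInertia) (map_add value a b)
  map_smul' c a := Subtype.ext <| congrArg (· ∘ commPairEquivInertia) (map_smul value c a)

theorem toInvariantFun_apply (a : deRhamTotal (Inertia (ConjGroupoid G))) (p : CommPair G) :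
    toInvariantFun a p = value a (commPairEquivInertia p) :=
  rfl

theorem toInvariantFun_bijective : Function.Bijective (toInvariantFun (G := G)) := by
  constructor
  · intro a b h
    have comp_eq : value a ∘ commPairEquivInertia = value b ∘ commPairEquivInertia :=
      congrArg Subtype.val h
    exact value_injective (commPairEquivInertia.surjective.injective_comp_right comp_eq)
  · intro f
    have invariant (x y : Inertia (ConjGroupoid G)) (k : x ⟶ y) :
        f (commPairEquivInertia.symm y) = f (commPairEquivInertia.symm x) := by
      obtain ⟨k, hk⟩ := exists_eq_conj_of_hom k
      rw [hk, f.apply_conj]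
    obtain ⟨a, ha⟩ := exists_value_eq invariant
    refine ⟨a, DFunLike.ext _ _ fun p => ?_⟩
    rw [toInvariantFun_apply, ha]
    exact congrArg f (commPairEquivInertia.symm_apply_apply p)

theorem toInvariantFun_chenRuanMul [Finite G] (a b : deRhamTotal (Inertia (ConjGroupoid G))) :
    toInvariantFun (chenRuanMul a b) = toInvariantFun a * toInvariantFun b :=
  InvariantFun.ext_mk' fun g h => by
    rw [toInvariantFun_apply, commPairEquivInertia_mk', value_chenRuanMul, InvariantFun.mul_apply]
    exact finsum_comp_equiv (loopFactorizationEquiv g h)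
      (f := fun q => toInvariantFun a (CommPair.mk' g q.1.1) *
        toInvariantFun b (CommPair.mk' g q.1.2))

/-- The Chen–Ruan cohomology of `[G/G]` as the space of invariant functions on commuting pairs. -/
def invariantFunEquiv (G : Type u) [Group G] :
    ChenRuanCohomology (ConjGroupoid G) ≃ₗ[ℂ] InvariantFun G :=
  LinearEquiv.ofBijective toInvariantFun toInvariantFun_bijective

end ConjugationQuotient

end ChenRuan

end

theorem mainTheorem5 (G : Type*) [Group G] [Finite G] :
    ∃ φ : ChenRuan.ChenRuanCohomology (ChenRuan.ConjGroupoid G) ≃+* ChenRuan.InvariantFun G,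
      ∀ (c : ℂ) (a : ChenRuan.ChenRuanCohomology (ChenRuan.ConjGroupoid G)),
        φ (c • a) = c • φ a :=
  ⟨{ (ChenRuan.invariantFunEquiv G).toAddEquiv with
      map_mul' := ChenRuan.toInvariantFun_chenRuanMul }, (ChenRuan.invariantFunEquiv G).map_smul⟩
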